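/- Let $R$ be a commutative ring with nonzero identity and let $M$ be its Jacobson radical. A proper ideal $I$ of $R$ is called an $OA$-ideal ($1$-absorbing prime ideal) if for all nonunits $a,b,c\in R$ with $abc\in I$ we have $ab\in I$ or $c\in I$. An ideal of $R$ is called divided if it is comparable under inclusion to every ideal of $R$. The ring $R$ is called a unique factorization ring (in the sense of Fletcher) if every proper principal ideal of $R$ is a (finite) product of principal prime ideals. A ring is called local if it has exactly one maximal ideal (it need not be Noetherian). Then the following statements are equivalent. 1. Every proper principal ideal of $R$ is a (finite) product of principal $OA$-ideals. 2. $R$ satisfies one of the following conditions. - (A) $R$ is a unique factorization ring. - (B) $R$ is a local integral domain, $M^2$ is divided and $\bigcap_{n\geq 1} M^n=\boldsymbol{0}$. - (C) $R$ is local, $M^2$ is divided and $M$ is nilpotent, that is, $M^k=\boldsymbol{0}$ for some positive integer $k$. -/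

import Mathlib

/-- A `1`-absorbing prime ideal (`OA`-ideal): a proper ideal `I` such that for all nonunits
`a, b, c` with `a * b * c ∈ I`, either `a * b ∈ I` or `c ∈ I`. -/
def IsOAIdeal {R : Type*} [CommRing R] (I : Ideal R) : Prop :=
  I ≠ ⊤ ∧ ∀ a b c : R, ¬ IsUnit a → ¬ IsUnit b → ¬ IsUnit c →
    a * b * c ∈ I → a * b ∈ I ∨ c ∈ I

/-- `I` is a finite product of principal ideals each of which satisfies `P`.
(The empty product is the unit ideal, so it plays no role for proper `I`.) -/
def IsProductOfPrincipal {R : Type*} [CommRing R] (P : Ideal R → Prop) (I : Ideal R) : Prop :=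
  ∃ s : Multiset (Ideal R), (∀ J ∈ s, Submodule.IsPrincipal J ∧ P J) ∧ s.prod = I

/-- A unique factorization ring in the sense of Fletcher: every proper principal ideal is a
product of principal prime ideals. -/
def IsUniqueFactorizationRing (R : Type*) [CommRing R] : Prop :=
  ∀ I : Ideal R, I ≠ ⊤ → Submodule.IsPrincipal I → IsProductOfPrincipal Ideal.IsPrime I

/-- A divided ideal: it is comparable (under inclusion) to every ideal of the ring. -/
def IsDividedIdeal {R : Type*} [CommRing R] (I : Ideal R) : Prop :=
  ∀ J : Ideal R, I ≤ J ∨ J ≤ I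

open IsLocalRing

section

variable {R : Type*} [CommRing R]

/-! A nonprime OA-ideal contains every product of two nonunits. So either all principal OA-ideals
are prime, which is case (A), or `R` is local and some nonprime OA-ideal `(x)` contains `M ^ 2`. The
crux is `maximalIdeal_sq_le_of_notMem`: then every `a ∈ M \ M ^ 2` satisfies `M ^ 2 ≤ (a)`, so `M ^
2` is divided. Nonzero principal OA-ideals then contain `M ^ 2`, so products of them contain powers
of `M`, and Nakayama gives `⨅ M ^ n = ⊥`. Conversely, for `x ∈ M \ M ^ 2` dividedness gives `M ^ (n
+ 1) = x ^ n M`. A nonzero nonunit is thus `x ^ n * y` with `y ∈ M \ M ^ 2`, and both `(x)` and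
`(y)` contain `M ^ 2`, hence are OA. -/

theorem Ideal.IsPrime.isOAIdeal {I : Ideal R} (hI : I.IsPrime) : IsOAIdeal I :=
  ⟨hI.ne_top, fun _ _ _ _ _ _ h => hI.mem_or_mem h⟩

theorem IsProductOfPrincipal.mono {P Q : Ideal R → Prop} (hPQ : ∀ J, J.IsPrincipal → P J → Q J)
    {I : Ideal R} (h : IsProductOfPrincipal P I) : IsProductOfPrincipal Q I := by
  obtain ⟨s, hs, hI⟩ := h
  exact ⟨s, fun J hJ => ⟨(hs J hJ).1, hPQ J (hs J hJ).1 (hs J hJ).2⟩, hI⟩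

/-- A `1`-absorbing prime ideal that is not prime contains every product of two nonunits. -/
theorem IsOAIdeal.mul_mem_of_not_isPrime {I : Ideal R} (hI : IsOAIdeal I) (hp : ¬ I.IsPrime)
    {a b : R} (ha : ¬ IsUnit a) (hb : ¬ IsUnit b) : a * b ∈ I := by
  rw [Ideal.isPrime_iff] at hp
  push Not at hp
  obtain ⟨x, y, hxy, hx, hy⟩ := hp hI.1
  have hxu : ¬ IsUnit x := fun h => hy ((I.unit_mul_mem_iff_mem h).1 hxy)
  have hyu : ¬ IsUnit y := fun h => hx ((I.mul_unit_mem_iff_mem h).1 hxy)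
  have hab : ¬ IsUnit (a * b) := fun h => ha (isUnit_of_mul_isUnit_left h)
  have h1 : a * b * x * y ∈ I := by
    rw [mul_assoc]
    exact I.mul_mem_left _ hxy
  have h2 := (hI.2 _ _ _ hab hxu hyu h1).resolve_right hy
  exact (hI.2 _ _ _ ha hb hxu h2).resolve_right hx

theorem IsOAIdeal.isLocalRing [Nontrivial R] {I : Ideal R} (hI : IsOAIdeal I)
    (hp : ¬ I.IsPrime) : IsLocalRing R := by
  refine ⟨fun {a b} hab => ?_⟩
  by_contra! h
  refine hI.1 (I.eq_top_iff_one.2 ?_)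
  -- Expanding `1 = (a + b) ^ 2` writes `1` as a sum of products of nonunits.
  have : (1 : R) = a * a + a * b + (b * a + b * b) := by
    linear_combination (-(a + b) - 1) * hab
  rw [this]
  exact I.add_mem
    (I.add_mem (hI.mul_mem_of_not_isPrime hp h.1 h.1) (hI.mul_mem_of_not_isPrime hp h.1 h.2))
    (I.add_mem (hI.mul_mem_of_not_isPrime hp h.2 h.1) (hI.mul_mem_of_not_isPrime hp h.2 h.2))

theorem pow_card_le_multiset_prod {I : Ideal R} {s : Multiset (Ideal R)} (h : ∀ J ∈ s, I ≤ J) :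
    I ^ s.card ≤ s.prod := by
  induction s using Multiset.induction with
  | empty => simp
  | cons J s ih =>
    rw [Multiset.card_cons, Multiset.prod_cons, pow_succ']
    exact Ideal.mul_mono (h J (by simp)) (ih fun K hK => h K (by simp [hK]))

variable [IsLocalRing R]

theorem IsOAIdeal.maximalIdeal_sq_le {I : Ideal R} (hI : IsOAIdeal I) (hp : ¬ I.IsPrime) :
    maximalIdeal R ^ 2 ≤ I := by
  rw [sq, Ideal.mul_le]
  exact fun a ha b hb => hI.mul_mem_of_not_isPrime hp ha hb

theorem isUnit_one_sub_of_mem_maximalIdeal {m : R} (hm : m ∈ maximalIdeal R) :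
    IsUnit (1 - m) :=
  isUnit_of_mem_nonunits_one_sub_self _ (by rwa [sub_sub_cancel])

theorem isOAIdeal_of_maximalIdeal_sq_le {I : Ideal R} (hI : I ≠ ⊤)
    (h : maximalIdeal R ^ 2 ≤ I) : IsOAIdeal I :=
  ⟨hI, fun _ _ _ ha hb _ _ => .inl (h (sq (maximalIdeal R) ▸ Ideal.mul_mem_mul ha hb))⟩

theorem span_singleton_ne_top_of_mem_maximalIdeal {a : R} (ha : a ∈ maximalIdeal R) :
    Ideal.span {a} ≠ ⊤ :=
  fun h => ha (Ideal.span_singleton_eq_top.1 h)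

/-- An element of `M \ M ^ 2` has no proper factorization into proper ideals. -/
theorem IsProductOfPrincipal.of_notMem_sq {P : Ideal R → Prop} (hP : ∀ J, P J → J ≠ ⊤)
    {a : R} (ha : a ∈ maximalIdeal R) (ha2 : a ∉ maximalIdeal R ^ 2)
    (h : IsProductOfPrincipal P (Ideal.span {a})) : P (Ideal.span {a}) := by
  obtain ⟨s, hs, hprod⟩ := h
  rcases s.empty_or_exists_mem with rfl | ⟨J, hJ⟩
  · exact absurd (by simpa using hprod.symm) (span_singleton_ne_top_of_mem_maximalIdeal ha)
  obtain ⟨t, rfl⟩ := Multiset.exists_cons_of_mem hJ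
  rcases t.empty_or_exists_mem with rfl | ⟨K, hK⟩
  · rw [← hprod]
    simpa using (hs J hJ).2
  obtain ⟨u, rfl⟩ := Multiset.exists_cons_of_mem hK
  refine absurd ?_ ha2
  have hle : Ideal.span {a} ≤ maximalIdeal R ^ 2 := by
    rw [← hprod, Multiset.prod_cons, Multiset.prod_cons, sq]
    refine Ideal.mul_mono (le_maximalIdeal (hP _ (hs J hJ).2)) (Ideal.mul_le_left.trans ?_)
    exact le_maximalIdeal (hP _ (hs K (by simp)).2)
  exact hle (Ideal.mem_span_singleton_self a)

/-- Otherwise `(a)` is prime, and so are all `(a + x ^ (n + 3))`, none containing a power of `x`. A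
zero divisor relation `a * (a - x * s) = 0` makes every `a + x ^ (n + 3)` divide `a - x * s`, to
which `a + x ^ 3` is associated. So `a + x ^ 4` divides `a + x ^ 3`, hence `x ^ 3`, a contradiction.
-/
theorem maximalIdeal_sq_le_of_notMem
    (H : ∀ a ∈ maximalIdeal R, IsProductOfPrincipal IsOAIdeal (Ideal.span {a}))
    {x : R} (hx : IsOAIdeal (Ideal.span {x})) (hxp : ¬ (Ideal.span {x}).IsPrime)
    {a : R} (ha : a ∈ maximalIdeal R) (ha2 : a ∉ maximalIdeal R ^ 2) :
    maximalIdeal R ^ 2 ≤ Ideal.span {a} := by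
  have hMx : maximalIdeal R ^ 2 ≤ Ideal.span {x} := hx.maximalIdeal_sq_le hxp
  have hxM : x ∈ maximalIdeal R :=
    le_maximalIdeal hx.1 (Ideal.mem_span_singleton_self x)
  have hprime : ∀ c ∈ maximalIdeal R, c ∉ maximalIdeal R ^ 2 →
      ¬ maximalIdeal R ^ 2 ≤ Ideal.span {c} → (Ideal.span {c}).IsPrime := by
    intro c hc hc2 hle
    by_contra hcp
    exact hle (((H c hc).of_notMem_sq (fun _ h => h.1) hc hc2).maximalIdeal_sq_le hcp)
  have hnx : ∀ c, ¬ maximalIdeal R ^ 2 ≤ Ideal.span {c} → ¬ c ∣ x := fun c hc h =>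
    hc (hMx.trans (Ideal.span_singleton_le_span_singleton.2 h))
  by_contra hle
  have hap := hprime a ha ha2 hle
  have hxa := hnx a hle
  have hda : ∀ {u v : R}, a ∣ u * v → a ∣ u ∨ a ∣ v := fun h => by
    simpa [Ideal.mem_span_singleton] using hap.mem_or_mem (Ideal.mem_span_singleton.2 h)
  -- An exponent above 2 lets `x ^ 2` factor out, leaving the unit `1 - x ^ (n + 1) * r`.
  have key : ∀ n : ℕ, maximalIdeal R ^ 2 ≤ Ideal.span {a + x ^ (n + 3)} → False := by
    intro n hn
    obtain ⟨r, hr⟩ := Ideal.mem_span_singleton.1 (hn (Ideal.pow_mem_pow hxM 2))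
    have h1 : a ∣ x * (x * (1 - x ^ (n + 1) * r)) := ⟨r, by linear_combination hr⟩
    have h2 := ((hda ((hda h1).resolve_left hxa)).resolve_left hxa)
    exact (maximalIdeal R).mem_of_dvd h2 ha (isUnit_one_sub_of_mem_maximalIdeal
      ((maximalIdeal R).mul_mem_right _ ((maximalIdeal R).pow_mem_of_mem hxM _ n.succ_pos)))
  have hx2 : ∀ n : ℕ, x ^ (n + 3) ∈ maximalIdeal R ^ 2 := fun n =>
    Ideal.pow_le_pow_right (by omega) (Ideal.pow_mem_pow hxM (n + 3))
  have hc : ∀ n : ℕ, ∀ {u v : R}, a + x ^ (n + 3) ∣ u * v →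
      a + x ^ (n + 3) ∣ u ∨ a + x ^ (n + 3) ∣ v := by
    intro n u v h
    have hp := hprime (a + x ^ (n + 3))
      ((maximalIdeal R).add_mem ha (Ideal.pow_le_self two_ne_zero (hx2 n)))
      (fun h => ha2 (((maximalIdeal R ^ 2).add_mem_iff_left (hx2 n)).1 h)) (key n)
    simpa [Ideal.mem_span_singleton] using hp.mem_or_mem (Ideal.mem_span_singleton.2 h)
  have hcx : ∀ n : ℕ, ¬ a + x ^ (n + 3) ∣ x := fun n => hnx _ (key n)
  have hcxpow : ∀ n k : ℕ, ¬ a + x ^ (n + 3) ∣ x ^ k := by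
    intro n k
    induction k with
    | zero =>
      intro h
      exact hcx n ((by simpa using h : a + x ^ (n + 3) ∣ 1).trans (one_dvd _))
    | succ k ih =>
      intro h
      exact (hc n (pow_succ x k ▸ h)).elim ih (hcx n)
  obtain ⟨t, ht⟩ := Ideal.mem_span_singleton.1 (hMx (Ideal.pow_mem_pow ha 2))
  obtain ⟨s, rfl⟩ : a ∣ t := (hda ⟨a, by rw [← ht, sq]⟩).resolve_left hxa
  have hb : ∀ n : ℕ, a + x ^ (n + 3) ∣ a - x * s := by
    intro n
    have h0 : a + x ^ (n + 3) ∣ a * (a - x * s) := by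
      rw [show a * (a - x * s) = 0 by linear_combination ht]
      exact dvd_zero _
    refine (hc n h0).resolve_left fun h => hcxpow n (n + 3) ?_
    simpa using dvd_sub (dvd_refl (a + x ^ (n + 3))) h
  have hs : a + x ^ 3 ∣ s + x ^ 2 := by
    have h : a + x ^ (0 + 3) ∣ x * (s + x ^ 2) := by
      rw [show x * (s + x ^ 2) = (a + x ^ (0 + 3)) - (a - x * s) by ring]
      exact dvd_sub (dvd_refl _) (hb 0)
    exact (hc 0 h).resolve_left (hcx 0)
  obtain ⟨q, hq⟩ := hs
  have hu : ∀ z : R, IsUnit (1 - x * z) := fun z =>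
    isUnit_one_sub_of_mem_maximalIdeal ((maximalIdeal R).mul_mem_right z hxM)
  have h34 : a + x ^ (1 + 3) ∣ a + x ^ 3 := by
    have h : a + x ^ (1 + 3) ∣ (a + x ^ 3) * (1 - x * q) := by
      rw [show (a + x ^ 3) * (1 - x * q) = a - x * s by linear_combination x * hq]
      exact hb 1
    exact (hu q).dvd_mul_right.1 h
  have h : a + x ^ (1 + 3) ∣ x ^ 3 * (1 - x * 1) := by
    rw [show x ^ 3 * (1 - x * 1) = (a + x ^ 3) - (a + x ^ (1 + 3)) by ring]
    exact dvd_sub h34 (dvd_refl _)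
  exact hcxpow 1 3 ((hu 1).dvd_mul_right.1 h)

theorem isDividedIdeal_of_forall_notMem {I : Ideal R}
    (h : ∀ a ∈ maximalIdeal R, a ∉ I → I ≤ Ideal.span {a}) :
    IsDividedIdeal I := by
  intro J
  refine or_iff_not_imp_right.2 fun hJ => ?_
  obtain ⟨a, haJ, haI⟩ := SetLike.not_le_iff_exists.1 hJ
  by_cases ha : a ∈ maximalIdeal R
  · exact (h a ha haI).trans ((Ideal.span_singleton_le_iff_mem J).2 haJ)
  · rw [J.eq_top_of_isUnit_mem haJ (by simpa using ha)]
    exact le_top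

/-- If there is a nonprime principal `OA`-ideal, then a nonzero principal `OA`-ideal contains the
square of the maximal ideal. -/
theorem IsOAIdeal.eq_bot_or_maximalIdeal_sq_le
    (H : ∀ a ∈ maximalIdeal R, IsProductOfPrincipal IsOAIdeal (Ideal.span {a}))
    {x : R} (hx : IsOAIdeal (Ideal.span {x})) (hxp : ¬ (Ideal.span {x}).IsPrime)
    {p : R} (hp : IsOAIdeal (Ideal.span {p})) :
    Ideal.span {p} = ⊥ ∨ maximalIdeal R ^ 2 ≤ Ideal.span {p} := by
  refine or_iff_not_imp_right.2 fun hle => ?_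
  have hMx := hx.maximalIdeal_sq_le hxp
  have hpM : p ∈ maximalIdeal R := le_maximalIdeal hp.1 (Ideal.mem_span_singleton_self p)
  have hxM : x ∈ maximalIdeal R := le_maximalIdeal hx.1 (Ideal.mem_span_singleton_self x)
  have hpp : (Ideal.span {p}).IsPrime := by
    by_contra h
    exact hle (hp.maximalIdeal_sq_le h)
  have hp2 : p ∈ maximalIdeal R ^ 2 := by
    by_contra h
    exact hle (maximalIdeal_sq_le_of_notMem H hx hxp hpM h)
  -- As `x ∉ (p)`, primeness puts the cofactor `t` in `(p)`, so `p` is killed by a unit `1 - x * r`.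
  obtain ⟨t, ht⟩ := Ideal.mem_span_singleton.1 (hMx hp2)
  rcases hpp.mem_or_mem (ht ▸ Ideal.mem_span_singleton_self p : x * t ∈ Ideal.span {p})
    with h | h
  · exact absurd (hMx.trans ((Ideal.span_singleton_le_iff_mem _).2 h)) hle
  · obtain ⟨r, rfl⟩ := Ideal.mem_span_singleton.1 h
    have hu : IsUnit (1 - x * r) :=
      isUnit_one_sub_of_mem_maximalIdeal ((maximalIdeal R).mul_mem_right r hxM)
    rw [Ideal.span_singleton_eq_bot]
    exact (hu.mul_left_eq_zero).1 (by linear_combination ht)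

/-- If there is a nonprime principal `OA`-ideal, then a proper principal ideal contains a
power of the maximal ideal unless it vanishes and the zero ideal is an `OA`-ideal. -/
theorem exists_maximalIdeal_pow_le
    (H : ∀ a ∈ maximalIdeal R, IsProductOfPrincipal IsOAIdeal (Ideal.span {a}))
    {x : R} (hx : IsOAIdeal (Ideal.span {x})) (hxp : ¬ (Ideal.span {x}).IsPrime)
    {a : R} (ha : a ∈ maximalIdeal R) :
    (a = 0 ∧ IsOAIdeal (⊥ : Ideal R)) ∨ ∃ n, maximalIdeal R ^ n ≤ Ideal.span {a} := by
  obtain ⟨s, hs, hprod⟩ := H a ha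
  by_cases h0 : ⊥ ∈ s
  · left
    refine ⟨?_, (hs _ h0).2⟩
    rw [← Ideal.span_singleton_eq_bot, ← hprod]
    exact Multiset.prod_eq_zero h0
  · right
    refine ⟨2 * s.card, ?_⟩
    rw [pow_mul, ← hprod]
    refine pow_card_le_multiset_prod fun J hJ => ?_
    obtain ⟨hJp, hJ1⟩ := hs J hJ
    obtain ⟨p, rfl⟩ := hJp
    exact (IsOAIdeal.eq_bot_or_maximalIdeal_sq_le H hx hxp hJ1).resolve_left fun h => h0 (h ▸ hJ)

theorem iInf_maximalIdeal_pow_eq_bot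
    (H : ∀ a ∈ maximalIdeal R, a ≠ 0 → ∃ n, maximalIdeal R ^ n ≤ Ideal.span {a}) :
    ⨅ n : ℕ, maximalIdeal R ^ n = ⊥ := by
  rw [eq_bot_iff]
  intro a ha
  rw [Ideal.mem_iInf] at ha
  by_contra h0
  obtain ⟨n, hn⟩ := H a (by simpa using ha 1) h0
  -- `a ∈ M ^ (n + 1) = M * M ^ n ≤ M * (a)`, so Nakayama applies.
  have h1 : Ideal.span {a} ≤ maximalIdeal R * Ideal.span {a} := by
    rw [Ideal.span_singleton_le_iff_mem]
    have := ha (n + 1)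
    rw [pow_succ'] at this
    exact Ideal.mul_mono_right hn this
  have h2 := Submodule.eq_bot_of_le_smul_of_le_jacobson_bot _ _
    (Submodule.fg_span_singleton a) h1 (maximalIdeal_le_jacobson _)
  exact h0 (Ideal.span_singleton_eq_bot.1 h2)

/-- Factor the zero ideal: either `⊥` is itself OA, hence prime or containing `M ^ 2`, or it
contains a power of `M`. -/
theorem isDomain_or_isNilpotent_of_isOAIdeal
    (H : ∀ a ∈ maximalIdeal R, IsProductOfPrincipal IsOAIdeal (Ideal.span {a}))
    {x : R} (hx : IsOAIdeal (Ideal.span {x})) (hxp : ¬ (Ideal.span {x}).IsPrime) :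
    IsDomain R ∨ IsNilpotent (maximalIdeal R) := by
  rw [or_iff_not_imp_left]
  intro hd
  have nil : ∀ n, maximalIdeal R ^ n ≤ ⊥ → IsNilpotent (maximalIdeal R) := fun n hn =>
    ⟨n, le_bot_iff.1 hn⟩
  rcases exists_maximalIdeal_pow_le H hx hxp (maximalIdeal R).zero_mem with ⟨-, h⟩ | ⟨n, hn⟩
  · exact nil 2 (h.maximalIdeal_sq_le fun hp => hd (IsDomain.of_bot_isPrime R))
  · exact nil n (by simpa using hn)

/-- Elements of `M ^ 2 ≤ (x)` have a nonunit cofactor, since otherwise `x ∈ M ^ 2`; so `M ^ 2 = x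
M`. -/
theorem maximalIdeal_pow_succ_eq (hdiv : IsDividedIdeal (maximalIdeal R ^ 2)) {x : R}
    (hx : x ∈ maximalIdeal R) (hx2 : x ∉ maximalIdeal R ^ 2) (n : ℕ) :
    maximalIdeal R ^ (n + 1) = Ideal.span {x} ^ n * maximalIdeal R := by
  have h2 : maximalIdeal R ^ 2 = Ideal.span {x} * maximalIdeal R := by
    refine le_antisymm (fun m hm => ?_) ?_
    · have hle := (hdiv (Ideal.span {x})).resolve_right fun h =>
        hx2 (h (Ideal.mem_span_singleton_self x))
      obtain ⟨r, rfl⟩ := Ideal.mem_span_singleton.1 (hle hm)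
      refine Ideal.mul_mem_mul (Ideal.mem_span_singleton_self x) fun hr => hx2 ?_
      exact ((maximalIdeal R ^ 2).mul_unit_mem_iff_mem hr).1 hm
    · rw [sq]
      exact Ideal.mul_mono_left ((Ideal.span_singleton_le_iff_mem _).2 hx)
  induction n with
  | zero => simp
  | succ n ih => rw [pow_succ, ih, mul_assoc, ← sq, h2, pow_succ, mul_assoc]

theorem isProductOfPrincipal_isOAIdeal (hdiv : IsDividedIdeal (maximalIdeal R ^ 2))
    (hinf : ⨅ n : ℕ, maximalIdeal R ^ n = ⊥)
    (hzero : IsDomain R ∨ IsNilpotent (maximalIdeal R)) {a : R} (ha : a ∈ maximalIdeal R) :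
    IsProductOfPrincipal IsOAIdeal (Ideal.span {a}) := by
  have hOA : ∀ y ∈ maximalIdeal R, y ∉ maximalIdeal R ^ 2 →
      (Ideal.span {y}).IsPrincipal ∧ IsOAIdeal (Ideal.span {y}) := fun y hy hy2 =>
    ⟨⟨y, rfl⟩, isOAIdeal_of_maximalIdeal_sq_le (span_singleton_ne_top_of_mem_maximalIdeal hy)
      ((hdiv _).resolve_right fun h => hy2 (h (Ideal.mem_span_singleton_self y)))⟩
  have hbot : (⊥ : Ideal R).IsPrime → IsProductOfPrincipal IsOAIdeal (⊥ : Ideal R) := fun h =>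
    ⟨{⊥}, by simpa using ⟨bot_isPrincipal, h.isOAIdeal⟩, by simp⟩
  -- If `M = M ^ 2`, then `M` lies in all its powers and vanishes, so `R` is a field.
  by_cases hM : maximalIdeal R ≤ maximalIdeal R ^ 2
  · have hMbot : maximalIdeal R = ⊥ := by
      rw [← le_bot_iff, ← hinf]
      refine le_iInf fun n => ?_
      induction n with
      | zero => simp
      | succ n ih =>
        rw [pow_succ]
        exact hM.trans (sq (maximalIdeal R) ▸ Ideal.mul_mono_left ih)
    have ha0 : a = 0 := by simpa [hMbot] using ha
    rw [ha0, Ideal.span_singleton_zero]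
    exact hbot (hMbot ▸ (maximalIdeal.isMaximal R).isPrime)
  obtain ⟨x, hx, hx2⟩ := SetLike.not_le_iff_exists.1 hM
  by_cases ha0 : a = 0
  · rw [ha0, Ideal.span_singleton_zero]
    rcases hzero with hd | ⟨k, hk⟩
    · exact hbot Ideal.isPrime_bot
    · refine ⟨Multiset.replicate k (Ideal.span {x}), fun J hJ => ?_, ?_⟩
      · rw [Multiset.eq_of_mem_replicate hJ]
        exact hOA x hx hx2
      · rw [Multiset.prod_replicate, ← le_bot_iff]
        exact (Ideal.pow_right_mono ((Ideal.span_singleton_le_iff_mem _).2 hx) k).trans hk.le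
  · have hex : ∃ n, a ∉ maximalIdeal R ^ n := by
      by_contra! h
      exact ha0 (by simpa [hinf] using (Ideal.mem_iInf (x := a)).2 h)
    classical
    -- The least power omitting `a` is at least the second, since `a ∈ M`.
    obtain ⟨n, hn⟩ : ∃ n, Nat.find hex = n + 2 := by
      refine ⟨Nat.find hex - 2, ?_⟩
      have : 1 < Nat.find hex := by
        rw [Nat.lt_find_iff]
        intro m hm
        interval_cases m <;> simp [ha]
      omega
    have h1 : a ∈ maximalIdeal R ^ (n + 1) :=
      not_not.1 (Nat.find_min hex (by omega : n + 1 < Nat.find hex))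
    have h2 : a ∉ maximalIdeal R ^ (n + 2) := hn ▸ Nat.find_spec hex
    rw [maximalIdeal_pow_succ_eq hdiv hx hx2, Ideal.span_singleton_pow,
      Ideal.mem_span_singleton_mul] at h1
    obtain ⟨y, hy, rfl⟩ := h1
    have hy2 : y ∉ maximalIdeal R ^ 2 := fun h =>
      h2 (pow_add (maximalIdeal R) n 2 ▸ Ideal.mul_mem_mul (Ideal.pow_mem_pow hx n) h)
    refine ⟨Ideal.span {y} ::ₘ Multiset.replicate n (Ideal.span {x}), fun J hJ => ?_, ?_⟩
    · rcases Multiset.mem_cons.1 hJ with rfl | hJ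
      · exact hOA y hy hy2
      · rw [Multiset.eq_of_mem_replicate hJ]
        exact hOA x hx hx2
    · rw [Multiset.prod_cons, Multiset.prod_replicate, Ideal.span_singleton_pow,
        Ideal.span_singleton_mul_span_singleton, mul_comm]

end

theorem corollary4 {R : Type*} [CommRing R] [Nontrivial R] (M : Ideal R)
    (hM : M = Ideal.jacobson (⊥ : Ideal R)) :
    (∀ I : Ideal R, I ≠ ⊤ → Submodule.IsPrincipal I → IsProductOfPrincipal IsOAIdeal I) ↔
      (IsUniqueFactorizationRing R ∨
        (IsLocalRing R ∧ IsDomain R ∧ IsDividedIdeal (M ^ 2) ∧ (⨅ n : ℕ, M ^ n) = ⊥) ∨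
        (IsLocalRing R ∧ IsDividedIdeal (M ^ 2) ∧ IsNilpotent M)) := by
  have hMmax : ∀ _ : IsLocalRing R, M = maximalIdeal R := fun _ => by
    rw [hM, jacobson_eq_maximalIdeal _ bot_ne_top]
  constructor
  · intro H
    by_cases hall : ∀ J : Ideal R, J.IsPrincipal → IsOAIdeal J → J.IsPrime
    · exact .inl fun I hI hIp => (H I hI hIp).mono hall
    push Not at hall
    obtain ⟨_, ⟨x, rfl⟩, hx, hxp⟩ := hall
    have hloc : IsLocalRing R := hx.isLocalRing hxp
    rw [hMmax hloc]
    have H' : ∀ a ∈ maximalIdeal R, IsProductOfPrincipal IsOAIdeal (Ideal.span {a}) :=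
      fun a ha => H _ (span_singleton_ne_top_of_mem_maximalIdeal ha) ⟨a, rfl⟩
    have hdiv : IsDividedIdeal (maximalIdeal R ^ 2) := isDividedIdeal_of_forall_notMem
      (fun a ha ha2 => maximalIdeal_sq_le_of_notMem H' hx hxp ha ha2)
    rcases isDomain_or_isNilpotent_of_isOAIdeal H' hx hxp with hd | hn
    · refine .inr (.inl ⟨hloc, hd, hdiv, iInf_maximalIdeal_pow_eq_bot fun a ha ha0 => ?_⟩)
      exact (exists_maximalIdeal_pow_le H' hx hxp ha).resolve_left fun h => ha0 h.1
    · exact .inr (.inr ⟨hloc, hdiv, hn⟩)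
  · rintro (h | ⟨hloc, hd, hdiv, hinf⟩ | ⟨hloc, hdiv, hn⟩) I hI hIp
    · exact (h I hI hIp).mono fun _ _ hJ => hJ.isOAIdeal
    · obtain ⟨a, rfl⟩ := hIp
      rw [hMmax hloc] at hdiv hinf
      exact isProductOfPrincipal_isOAIdeal hdiv hinf (.inl hd)
        (le_maximalIdeal hI (Ideal.mem_span_singleton_self a))
    · obtain ⟨a, rfl⟩ := hIp
      rw [hMmax hloc] at hdiv hn
      refine isProductOfPrincipal_isOAIdeal hdiv ?_ (.inr hn)
        (le_maximalIdeal hI (Ideal.mem_span_singleton_self a))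
      obtain ⟨k, hk⟩ := hn
      exact le_bot_iff.1 ((iInf_le _ k).trans hk.le)
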